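/- A quadriculated disk $\Delta$ is a closed topological disk formed by the juxtaposition along sides of finitely many squares (a square being a topological disk with four marked boundary points, its vertices), such that every vertex in the interior of $\Delta$ belongs to precisely four squares. The squares are colored black and white so that squares with a common side have opposite colors; label the black squares by $1,\dots,b$ and the white squares by $1,\dots,w$, in any order. The black-to-white matrix $B_\Delta$ is the $b\times w$ integer matrix whose $(i,j)$ entry is $1$ if the $i$-th black and the $j$-th white square share a side, and $0$ otherwise. Let $\Delta$ be a quadriculated disk with black-to-white matrix $B_\Delta$. Then: 1. for every $v\in\mathbb{Z}^b$, if the system $B_\Delta x=v$ has a solution $x\in\mathbb{Q}^w$, then it has a solution $x\in\mathbb{Z}^w$; 2. the cokernel $\mathbb{Z}^b/B_\Delta(\mathbb{Z}^w)$ of $B_\Delta:\mathbb{Z}^w\to\mathbb{Z}^b$ is a free abelian group; 3. for every prime $p$, the rank of $B_\Delta$ over $\mathbb{F}_p$ equals its rank over $\mathbb{Q}$. -/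

import Mathlib

open scoped unitInterval

/-- A point of the boundary of the model square `[0,1] × [0,1]`: side `i` is run through
counterclockwise, from vertex `i` to vertex `i + 1`, as `t` goes from `0` to `1`. The vertices
`0, 1, 2, 3` are `(0,0), (1,0), (1,1), (0,1)`. -/
def sidePoint (i : Fin 4) (t : I) : I × I :=
  ![(t, 0), (1, t), (σ t, 1), (0, σ t)] i

/-- Instructions for juxtaposing squares along sides. The squares are indexed by `F`, the sides of
the square `f` are the `(f, i)` with `i : Fin 4`. `mate s = some s'` says that the side `s` is glued
to the side `s'`, and `mate s = none` that `s` is glued to no other side. -/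
structure SquareGluing (F : Type*) where
  mate : F × Fin 4 → Option (F × Fin 4)
  mate_symm : ∀ s s', mate s = some s' → mate s' = some s
  mate_ne_self : ∀ s, mate s ≠ some s

namespace SquareGluing

variable {F : Type*} (G : SquareGluing F)

/-- The identifications of points in the disjoint union of the squares: glued sides are identified
with opposite directions. (All squares are parametrized compatibly with one orientation of the
resulting surface, so that the two squares at a common side run through it in opposite
directions.) -/
inductive PointRel : (Σ _ : F, I × I) → (Σ _ : F, I × I) → Prop
  | glue (f g : F) (i j : Fin 4) (h : G.mate (f, i) = some (g, j)) (t : I) :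
      PointRel ⟨f, sidePoint i t⟩ ⟨g, sidePoint j (σ t)⟩

/-- The topological space obtained by gluing: the disjoint union of the squares modulo the
equivalence relation generated by the identifications, with the quotient topology. -/
abbrev Space : Type _ := Quot G.PointRel

/-- The point of the glued space at parameter `t` of the side `s`. -/
def sideMap (s : F × Fin 4) (t : I) : G.Space :=
  Quot.mk _ ⟨s.1, sidePoint s.2 t⟩

/-- The point of the glued space at the corner `c = (f, i)`, i.e. at vertex `i` of the
square `f`. -/
def vertex (c : F × Fin 4) : G.Space := G.sideMap c 0

/-- The boundary of the glued surface: the union of the sides that are glued to no other side. -/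
def boundary : Set G.Space :=
  {x | ∃ s t, G.mate s = none ∧ G.sideMap s t = x}

/-- `G` describes a quadriculated disk: the glued space is a closed topological disk, and every
interior vertex belongs to precisely four squares (exactly four corners of squares are at it). -/
structure IsQuadriculatedDisk : Prop where
  disk : Nonempty (G.Space ≃ₜ Metric.closedBall (0 : EuclideanSpace ℝ (Fin 2)) 1)
  four : ∀ c : F × Fin 4, G.vertex c ∉ G.boundary →
    {c' : F × Fin 4 | G.vertex c' = G.vertex c}.ncard = 4

/-- Two squares share a side. -/
def ShareSide (f g : F) : Prop :=
  ∃ i j : Fin 4, G.mate (f, i) = some (g, j)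

/-- A bicoloring of the squares (`true` is black, `false` is white): squares with a common side have
opposite colors. -/
def IsBicoloring (color : F → Bool) : Prop :=
  ∀ f g, G.ShareSide f g → color f ≠ color g

open Classical in
/-- The `b × w` black-to-white matrix, for a labeling `black` of the black squares by `Fin b`
and a labeling `white` of the white squares by `Fin w`. -/
noncomputable def blackToWhite {color : F → Bool} {b w : ℕ}
    (black : Fin b ≃ {f : F // color f = true}) (white : Fin w ≃ {f : F // color f = false}) :
    Matrix (Fin b) (Fin w) ℤ :=
  Matrix.of fun i j => if G.ShareSide (black i) (white j) then 1 else 0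

end SquareGluing

/-!
After a twist by signs, the neighbor sum of a function on the white squares at a black square `f`
becomes `± (y₀ - y₁ + y₂ - y₃)`, where `yᵢ` is the value across the side `i` of `f`; the signs exist
because a disk has a consistent notion of horizontal and vertical sides. So a vector in the kernel
modulo `n` becomes a function `y` on the sides that is constant around each white square, vanishes
on the unglued sides of black squares, and has alternating sums divisible by `n`.

Modulo `n`, the differences of `y` across the corners of the squares form a flow on a graph on the
vertices, with edges the diagonals of the black squares and the unglued sides of the white ones.
Flows modulo `n` on a graph lift to integral flows, and integral corner differences integrate back
to a function on sides, because continuous circle-valued functions on the disk lift to the line.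
Hence kernel vectors modulo `n` lift to integral kernel vectors, so the image of the matrix is
saturated and its cokernel is torsion-free; the three claims follow.
-/

open Function

section Topology

variable {X : Type*} [TopologicalSpace X]

theorem exists_continuousMap_lift_addCircle [SimplyConnectedSpace X] [LocallyPathConnectedSpace X]
    (p : ℝ) [DiscreteTopology (AddSubgroup.zmultiples p)] (h : C(X, AddCircle p)) :
    ∃ H : C(X, ℝ), ∀ x, (H x : AddCircle p) = h x := by
  obtain ⟨x₀⟩ := (inferInstance : Nonempty X)
  obtain ⟨r, hr⟩ := QuotientAddGroup.mk_surjective (h x₀)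
  obtain ⟨H, ⟨-, hH⟩, -⟩ :=
    (AddCircle.isCoveringMap_coe p).existsUnique_continuousMap_lifts h x₀ r hr
  exact ⟨H, congrFun hH⟩

theorem exists_int_sub_eq_of_addCircle_eq [PreconnectedSpace X] [Nonempty X] {u v : X → ℝ}
    (hu : Continuous u) (hv : Continuous v)
    (huv : ∀ x, (u x : AddCircle (1 : ℝ)) = v x) : ∃ n : ℤ, ∀ x, u x - v x = n := by
  have hinteger (x : X) : ∃ n : ℤ, (n : ℝ) = u x - v x := by
    have := huv x
    rw [← sub_eq_zero, ← AddCircle.coe_sub, AddCircle.coe_eq_zero_iff] at this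
    simpa only [zsmul_one] using this
  choose n hn using hinteger
  have hcont : Continuous n := by
    rw [Int.isClosedEmbedding_coe_real.isEmbedding.continuous_iff,
      show ((↑) : ℤ → ℝ) ∘ n = fun x => u x - v x from funext hn]
    exact hu.sub hv
  obtain ⟨x₀⟩ := ‹Nonempty X›
  exact ⟨n x₀, fun x => by rw [← hn x, PreconnectedSpace.constant ‹_› hcont (x := x) (y := x₀)]⟩

theorem locallyPathConnectedSpace_unitInterval : LocallyPathConnectedSpace I :=
  (isQuotientMap_projIcc (h := zero_le_one)).locallyPathConnectedSpace

end Topology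

section Coboundary

variable {α : Type*} {f : α → α}

theorem exists_sub_apply_eq_of_birkhoffSum_eq_zero (hf : ∀ x, x ∈ periodicPts f) {t : α → ℝ}
    (ht : ∀ x, birkhoffSum f t (minimalPeriod f x) x = 0) :
    ∃ a : α → ℝ, ∀ x, a x - a (f x) = t x := by
  refine ⟨fun x => (∑ j ∈ Finset.range (minimalPeriod f x), birkhoffSum f t j x) /
    minimalPeriod f x, fun x => ?_⟩
  have hpos : (minimalPeriod f x : ℝ) ≠ 0 :=
    Nat.cast_ne_zero.2 (minimalPeriod_pos_of_mem_periodicPts (hf x)).ne'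
  have hstep : ∀ j, birkhoffSum f t j x - birkhoffSum f t j (f x) = t x - t (f^[j] x) := fun j => by
    rw [← neg_sub, birkhoffSum_apply_sub_birkhoffSum, neg_sub]
  beta_reduce
  rw [minimalPeriod_apply (hf x), ← sub_div, ← Finset.sum_sub_distrib,
    Finset.sum_congr rfl fun j _ => hstep j, Finset.sum_sub_distrib, ← birkhoffSum, ht]
  simp [hpos]

theorem birkhoffSum_minimalPeriod_apply {A : Type*} [AddCommGroup A] (hf : ∀ x, x ∈ periodicPts f)
    (t : α → A) (x : α) :
    birkhoffSum f t (minimalPeriod f (f x)) (f x) = birkhoffSum f t (minimalPeriod f x) x := by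
  rw [minimalPeriod_apply (hf x), ← sub_eq_zero, birkhoffSum_apply_sub_birkhoffSum,
    iterate_minimalPeriod, sub_self]

theorem birkhoffSum_sub_comp {A : Type*} [AddCommGroup A] (t : α → A) (n : ℕ) (x : α) :
    birkhoffSum f (t - t ∘ f) n x = t x - t (f^[n] x) := by
  simp only [birkhoffSum, Pi.sub_apply, comp_apply, ← iterate_succ_apply']
  exact Finset.sum_range_sub' (fun k => t (f^[k] x)) n

theorem birkhoffSum_mul_of_comp_eq {R : Type*} [NonUnitalNonAssocSemiring R] {q : α → R}
    (hq : ∀ x, q (f x) = q x) (t : α → R) (n : ℕ) (x : α) :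
    birkhoffSum f (fun y => t y * q y) n x = birkhoffSum f t n x * q x := by
  have hiter : ∀ k, q (f^[k] x) = q x := fun k => by
    induction k with
    | zero => rfl
    | succ k ih => rw [iterate_succ_apply', hq, ih]
  simp only [birkhoffSum, hiter, Finset.sum_mul]

theorem exists_sub_apply_eq_of_notMem (hf : ∀ x, x ∈ periodicPts f) {t : α → ℝ} {D : Set α}
    (ht : ∀ x, (∀ k, f^[k] x ∉ D) → birkhoffSum f t (minimalPeriod f x) x = 0) :
    ∃ a : α → ℝ, ∀ x ∉ D, a x - a (f x) = t x := by
  classical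
  let S (u : α → ℝ) (x : α) := birkhoffSum f u (minimalPeriod f x) x
  have hS (u : α → ℝ) (x : α) : S u (f x) = S u x := birkhoffSum_minimalPeriod_apply hf u x
  let d := D.indicator (1 : α → ℝ)
  -- Each periodic sum is spread evenly over the points of `D` on its orbit.
  have hS₀ (x : α) (hx : S d x = 0) : S t x = 0 := by
    refine ht x fun k hk => ?_
    have hlt := Nat.mod_lt k (minimalPeriod_pos_of_mem_periodicPts (hf x))
    have := (Finset.sum_eq_zero_iff_of_nonneg fun j _ =>
      Set.indicator_nonneg (fun _ _ => zero_le_one) _).1 hx _ (Finset.mem_range.2 hlt)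
    rw [iterate_mod_minimalPeriod_eq] at this
    simp [hk] at this
  obtain ⟨a, ha⟩ := exists_sub_apply_eq_of_birkhoffSum_eq_zero hf
      (t := t - fun x => d x * (S t x / S d x)) fun x => by
    rw [birkhoffSum_sub, birkhoffSum_mul_of_comp_eq fun y => by rw [hS, hS]]
    exact sub_eq_zero.2 (mul_div_cancel_of_imp' (hS₀ x)).symm
  exact ⟨a, fun x hx => by simpa [d, hx] using ha x⟩

end Coboundary

section DirectImage

theorem sum_smul_funOnFinite_linearMap {R M α β : Type*} [Semiring R] [AddCommMonoid M]
    [Module R M] [Fintype α] [Fintype β] (f : α → β) (u : β → R) (s : α → M) :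
    ∑ b, u b • FunOnFinite.linearMap R M f s b = ∑ a, u (f a) • s a := by
  classical
  simp only [FunOnFinite.linearMap_apply_apply, Finset.smul_sum]
  rw [← Finset.sum_fiberwise Finset.univ f fun a => u (f a) • s a]
  refine Finset.sum_congr rfl fun b _ => Finset.sum_congr rfl fun a ha => ?_
  rw [(Finset.mem_filter.1 ha).2]

theorem sum_funOnFinite_linearMap {R M α β : Type*} [Semiring R] [AddCommMonoid M] [Module R M]
    [Fintype α] [Fintype β] (f : α → β) (s : α → M) :
    ∑ b, FunOnFinite.linearMap R M f s b = ∑ a, s a := by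
  simpa using sum_smul_funOnFinite_linearMap f (1 : β → R) s

theorem mem_of_funOnFinite_linearMap_eq_zero {R V W : Type*} [Ring R] [Finite V] [Finite W]
    [DecidableEq V] {q : V → W} {S : Submodule R (V → R)}
    (hS : ∀ v w, q v = q w → Pi.single v 1 - Pi.single w 1 ∈ S) {m : V → R}
    (hm : FunOnFinite.linearMap R R q m = 0) : m ∈ S := by
  classical
  cases nonempty_fintype V
  obtain hV | hV := isEmpty_or_nonempty V
  · rw [Subsingleton.elim m 0]
    exact S.zero_mem
  let r := invFun q
  have hr (v : V) : q v = q (r (q v)) := (invFun_eq ⟨v, rfl⟩).symm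
  have hsum : m - FunOnFinite.linearMap R R (r ∘ q) m =
      ∑ v, m v • (Pi.single v 1 - Pi.single (r (q v)) 1 : V → R) := by
    nth_rw 1 2 [pi_eq_sum_univ' m]
    simp [map_sum, smul_sub, ← Pi.single_smul]
  rw [FunOnFinite.linearMap_comp, LinearMap.comp_apply, hm, map_zero, sub_zero] at hsum
  rw [hsum]
  exact S.sum_mem fun v _ => S.smul_mem _ (hS _ _ (hr v))

end DirectImage

section Flow

variable {E V : Type*} [Finite E] [Finite V]

/-- The net amount that enters each vertex when `φ e` units flow along each edge `e` of a directed
multigraph. Its kernel consists of the flows of the graph. -/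
noncomputable def netFlow (tail head : E → V) : (E → ℤ) →ₗ[ℤ] V → ℤ :=
  FunOnFinite.linearMap ℤ ℤ head - FunOnFinite.linearMap ℤ ℤ tail

theorem netFlow_comp_perm (q : E → V) (π : Equiv.Perm E) (φ : E → ℤ) :
    netFlow (q ∘ π) q φ = FunOnFinite.linearMap ℤ ℤ q (φ - φ ∘ π.symm) := by
  classical
  cases nonempty_fintype E
  have hπ : FunOnFinite.linearMap ℤ ℤ π φ = φ ∘ π.symm := by
    ext e
    simp [FunOnFinite.linearMap_apply_apply, ← Equiv.eq_symm_apply, Finset.sum_filter]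
  rw [netFlow, LinearMap.sub_apply, FunOnFinite.linearMap_comp, LinearMap.comp_apply, hπ, map_sub]

variable {tail head : E → V} {s : Set E}

theorem funOnFinite_linearMap_netFlow {W : Type*} [Finite W] {q : V → W}
    (hq : ∀ e ∈ s, q (tail e) = q (head e)) {φ : E → ℤ} (hφ : ∀ e ∉ s, φ e = 0) :
    FunOnFinite.linearMap ℤ ℤ q (netFlow tail head φ) = 0 := by
  classical
  cases nonempty_fintype E
  rw [netFlow, LinearMap.sub_apply, map_sub, ← LinearMap.comp_apply, ← LinearMap.comp_apply,
    ← FunOnFinite.linearMap_comp, ← FunOnFinite.linearMap_comp, sub_eq_zero]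
  ext w
  simp only [FunOnFinite.linearMap_apply_apply, Finset.sum_filter, comp_apply]
  refine Finset.sum_congr rfl fun e _ => ?_
  by_cases he : e ∈ s
  · rw [hq e he]
  · simp [hφ e he]

theorem exists_netFlow_eq_zero_of_dvd {n : ℤ} (hn : n ≠ 0) {φ : E → ℤ} (hφ : ∀ e ∉ s, φ e = 0)
    (hdvd : ∀ v, n ∣ netFlow tail head φ v) :
    ∃ ψ : E → ℤ, (∀ e ∉ s, ψ e = 0) ∧ netFlow tail head ψ = 0 ∧ ∀ e, n ∣ ψ e - φ e := by
  classical
  -- The fibres of `q` are the connected components of the graph with edge set `s`.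
  let S : Submodule ℤ (V → ℤ) := (Submodule.pi sᶜ fun _ => ⊥).map (netFlow tail head)
  let q : V → Quotient (Setoid.ker fun v => S.mkQ (Pi.single v 1)) := Quotient.mk _
  have hq (v w : V) : q v = q w ↔ Pi.single v 1 - Pi.single w 1 ∈ S :=
    Quotient.eq.trans (Submodule.Quotient.eq S)
  have hq_edge (e : E) (he : e ∈ s) : q (tail e) = q (head e) := by
    refine (hq _ _).2 (Submodule.mem_map.2 ⟨-Pi.single e 1, fun e' he' => ?_, ?_⟩)
    · simp [Pi.single_eq_of_ne (ne_of_mem_of_not_mem he he').symm]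
    · simp [netFlow, ← sub_eq_neg_add]
  choose m hm using hdvd
  have hm_smul : netFlow tail head φ = n • m := funext hm
  have hm_zero : FunOnFinite.linearMap ℤ ℤ q m = 0 := by
    refine (smul_eq_zero.1 ?_).resolve_left hn
    rw [← map_smul, ← hm_smul, funOnFinite_linearMap_netFlow hq_edge hφ]
  obtain ⟨χ, hχ, hχm⟩ := mem_of_funOnFinite_linearMap_eq_zero (fun v w => (hq v w).1) hm_zero
  refine ⟨φ - n • χ, fun e he => ?_, ?_, fun e => by simp⟩
  · simp [hφ e he, show χ e = 0 from hχ e he]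
  · rw [map_sub, map_smul, hm_smul, hχm, sub_self]

end Flow

namespace SquareGluing

section Sides

variable {F : Type*}

/-- The next side of the same square, counterclockwise; it starts where the given side ends. Sides
also stand for the corners at which they start. -/
def next : Equiv.Perm (F × Fin 4) := (Equiv.refl F).prodCongr (Equiv.addRight 1)

theorem next_apply (s : F × Fin 4) : next s = (s.1, s.2 + 1) := rfl

/-- The bilinear function on the unit square with value `v i` at vertex `i`. -/
def bilinear (v : Fin 4 → ℝ) (p : I × I) : ℝ :=
  (1 - p.1) * (1 - p.2) * v 0 + p.1 * (1 - p.2) * v 1 + p.1 * p.2 * v 2 + (1 - p.1) * p.2 * v 3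

theorem continuous_bilinear (v : Fin 4 → ℝ) : Continuous (bilinear v) := by
  unfold bilinear
  fun_prop

theorem bilinear_sidePoint (v : Fin 4 → ℝ) (i : Fin 4) (t : I) :
    bilinear v (sidePoint i t) = (1 - t) * v i + t * v (i + 1) := by
  fin_cases i <;> simp [bilinear, sidePoint, add_comm]

end Sides

section Disk

variable {F : Type*} {G : SquareGluing F}

/-- The functions on sides that change sign across glued sides, with no condition on the unglued
sides: the 1-cochains on the adjacencies of the squares. -/
def antisymm (G : SquareGluing F) (A : Type*) [AddCommGroup A] : Submodule ℤ (F × Fin 4 → A) where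
  carrier := {z | ∀ s s', G.mate s = some s' → z s' = -z s}
  add_mem' hy hz s s' h := by rw [Pi.add_apply, hy s s' h, hz s s' h, Pi.add_apply, neg_add]
  zero_mem' _ _ _ := by simp
  smul_mem' n z hz s s' h := by rw [Pi.smul_apply, hz s s' h, Pi.smul_apply, smul_neg]

theorem IsQuadriculatedDisk.contractibleSpace (hG : G.IsQuadriculatedDisk) :
    ContractibleSpace G.Space :=
  have := Metric.contractibleSpace_closedBall (x := (0 : EuclideanSpace ℝ (Fin 2))) zero_le_one
  hG.disk.some.contractibleSpace

theorem IsQuadriculatedDisk.nonempty (hG : G.IsQuadriculatedDisk) : Nonempty F := by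
  have := hG.contractibleSpace
  obtain ⟨⟨f, -⟩, -⟩ := Quot.exists_rep (Classical.arbitrary G.Space)
  exact ⟨f⟩

theorem IsQuadriculatedDisk.side_induction (hG : G.IsQuadriculatedDisk) {P : F × Fin 4 → Prop}
    (hnext : ∀ s, P s → P (next s)) (hmate : ∀ s s', G.mate s = some s' → P s → P s')
    {s : F × Fin 4} (hs : P s) (s' : F × Fin 4) : P s' := by
  have hrot (f : F) (i j : Fin 4) (h : P (f, i)) : P (f, j) := by
    have hadd (k : Fin 4) : P (f, i + k) := by
      induction k using Fin.induction with
      | zero => simpa using h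
      | succ k ih => simpa only [next_apply, add_assoc, Fin.coeSucc_eq_succ] using hnext _ ih
    simpa using hadd (j - i)
  let _ : TopologicalSpace Prop := ⊥
  have : DiscreteTopology Prop := ⟨rfl⟩
  let k : (Σ _ : F, I × I) → Prop := fun q => P (q.1, 0)
  have hk : Continuous k := continuous_sigma fun f => continuous_const (y := P (f, 0))
  have hrel (x y) (h : G.PointRel x y) : k x = k y := by
    obtain ⟨f, g, i, j, h, -⟩ := h
    exact propext ⟨fun hf => hrot g j 0 (hmate _ _ h (hrot f 0 i hf)),
      fun hf => hrot f i 0 (hmate _ _ (G.mate_symm _ _ h) (hrot g 0 j hf))⟩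
  have := hG.contractibleSpace
  have hconst := PreconnectedSpace.constant inferInstance (continuous_quot_lift hrel hk)
    (x := Quot.mk _ ⟨s.1, (0, 0)⟩) (y := Quot.mk _ ⟨s'.1, (0, 0)⟩)
  exact hrot _ _ _ (cast hconst (hrot _ _ _ hs))

/-- Corner values `a` extend bilinearly to the squares. The extensions fit together modulo `ℤ`, and
the resulting map from the disk to the circle lifts to the line. -/
theorem IsQuadriculatedDisk.exists_potential_of_corner (hG : G.IsQuadriculatedDisk)
    {t : F × Fin 4 → ℤ} (ht : t ∈ G.antisymm ℤ) {a : F × Fin 4 → ℝ}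
    (ha : ∀ s s', G.mate s = some s' → a s - a (next s') = t s) :
    ∃ τ : F → ℤ, ∀ s s', G.mate s = some s' → τ s.1 - τ s'.1 = t s := by
  let b : (Σ _ : F, I × I) → ℝ := fun q => bilinear (fun i => a (q.1, i)) q.2
  have hb : Continuous b := continuous_sigma fun f => continuous_bilinear fun i => a (f, i)
  have hglue (f g i j) (h : G.mate (f, i) = some (g, j)) (p : I) :
      b ⟨f, sidePoint i p⟩ - b ⟨g, sidePoint j (σ p)⟩ = t (f, i) := by
    have h0 := ha _ _ h
    have h1 := ha _ _ (G.mate_symm _ _ h)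
    rw [ht _ _ h] at h1
    simp only [b, bilinear_sidePoint, unitInterval.coe_symm_eq, next_apply, Int.cast_neg] at h0 h1 ⊢
    linear_combination (1 - (p : ℝ)) * h0 - (p : ℝ) * h1
  have hrel (x y) (h : G.PointRel x y) : (b x : AddCircle (1 : ℝ)) = b y := by
    obtain ⟨f, g, i, j, h, p⟩ := h
    rw [← sub_eq_zero, ← AddCircle.coe_sub, hglue f g i j h p, AddCircle.coe_eq_zero_iff]
    exact ⟨_, zsmul_one _⟩
  have := hG.contractibleSpace
  have := locallyPathConnectedSpace_unitInterval
  obtain ⟨H, hH⟩ := exists_continuousMap_lift_addCircle 1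
    ⟨_, continuous_quot_lift hrel ((AddCircle.continuous_mk' 1).comp hb)⟩
  have hτ (f : F) : ∃ n : ℤ, ∀ p : I × I, b ⟨f, p⟩ - H (Quot.mk _ ⟨f, p⟩) = n :=
    exists_int_sub_eq_of_addCircle_eq (hb.comp continuous_sigmaMk)
      (H.continuous.comp (continuous_quot_mk.comp continuous_sigmaMk)) fun p =>
        (hH (Quot.mk _ ⟨f, p⟩)).symm
  choose τ hτ using hτ
  refine ⟨τ, fun ⟨f, i⟩ ⟨g, j⟩ h => ?_⟩
  have hpoint : (Quot.mk G.PointRel ⟨f, sidePoint i 0⟩ : G.Space) =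
    Quot.mk G.PointRel ⟨g, sidePoint j (σ 0)⟩ := Quot.sound (.glue f g i j h 0)
  have : ((τ f - τ g : ℤ) : ℝ) = (t (f, i) : ℤ) := by
    rw [Int.cast_sub, ← hτ f (sidePoint i 0), ← hτ g (sidePoint j (σ 0)), hpoint,
      ← hglue f g i j h 0]
    ring
  exact_mod_cast this

end Disk

section Vertices

variable {F : Type*} (G : SquareGluing F)

/-- The permutation of the sides that exchanges glued sides and fixes the unglued ones. -/
def flip : Equiv.Perm (F × Fin 4) :=
  Involutive.toPerm (fun s => (G.mate s).getD s) fun s => by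
    cases h : G.mate s with
    | none => simp only [h, Option.getD_none]
    | some s' => simp only [h, Option.getD_some, G.mate_symm _ _ h]

/-- The permutation of the corners that turns clockwise around a vertex: it crosses the side that
starts at the corner. At an unglued side, where there is nothing to cross, it moves on to the end
of the side instead. -/
def turn : Equiv.Perm (F × Fin 4) := G.flip.trans next

/-- The combinatorial vertices: corners up to turning across glued sides. -/
def Vtx : Type _ := Quot fun c d => ∃ s, G.mate c = some s ∧ next s = d

/-- The combinatorial vertex at a corner. -/
def vtx (c : F × Fin 4) : G.Vtx := Quot.mk _ c

instance [Finite F] : Finite G.Vtx := Quot.finite _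

variable {G}

theorem vtx_surjective : Surjective G.vtx := Quot.mk_surjective

theorem flip_of_mate {s s' : F × Fin 4} (h : G.mate s = some s') : G.flip s = s' :=
  congrArg (Option.getD · s) h

theorem flip_of_mate_eq_none {s : F × Fin 4} (h : G.mate s = none) : G.flip s = s :=
  congrArg (Option.getD · s) h

theorem turn_apply (s : F × Fin 4) : G.turn s = next (G.flip s) := rfl

theorem turn_of_mate {s s' : F × Fin 4} (h : G.mate s = some s') : G.turn s = next s' := by
  rw [turn_apply, flip_of_mate h]

theorem turn_of_mate_eq_none {s : F × Fin 4} (h : G.mate s = none) : G.turn s = next s := by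
  rw [turn_apply, flip_of_mate_eq_none h]

theorem vtx_next_of_mate {s s' : F × Fin 4} (h : G.mate s = some s') :
    G.vtx (next s') = G.vtx s :=
  (Quot.sound ⟨s', h, rfl⟩).symm

theorem sidePoint_zero_eq_iff {i j : Fin 4} {t : I} :
    sidePoint j 0 = sidePoint i t ↔ (t = 0 ∧ j = i) ∨ (t = 1 ∧ j = i + 1) := by
  rw [eq_comm]
  fin_cases i <;> fin_cases j <;> simp [sidePoint]

theorem sidePoint_one (i : Fin 4) : sidePoint i 1 = sidePoint (i + 1) 0 :=
  (sidePoint_zero_eq_iff.2 (.inr ⟨rfl, rfl⟩)).symm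

/-- The set of combinatorial vertices at a point of a square. It has at most one element and allows
to read off the combinatorial vertex from a point of the glued space. -/
def vtxAt (G : SquareGluing F) (q : Σ _ : F, I × I) : Set G.Vtx :=
  {v | ∃ i, sidePoint i 0 = q.2 ∧ G.vtx (q.1, i) = v}

theorem mem_vtxAt_sidePoint {s : F × Fin 4} {t : I} {v : G.Vtx} :
    v ∈ G.vtxAt ⟨s.1, sidePoint s.2 t⟩ ↔
      (t = 0 ∧ G.vtx s = v) ∨ (t = 1 ∧ G.vtx (next s) = v) := by
  simp [vtxAt, sidePoint_zero_eq_iff, or_and_right, exists_or, and_assoc, next_apply]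

theorem vtxAt_eq_of_pointRel {q q' : Σ _ : F, I × I} (h : G.PointRel q q') :
    G.vtxAt q = G.vtxAt q' := by
  obtain ⟨f, g, i, j, h, t⟩ := h
  ext v
  rw [mem_vtxAt_sidePoint (s := (f, i)), mem_vtxAt_sidePoint (s := (g, j)), vtx_next_of_mate h,
    vtx_next_of_mate (G.mate_symm _ _ h), unitInterval.symm_eq_zero, unitInterval.symm_eq_one,
    or_comm]

/-- The set of combinatorial vertices at a point of the glued space. -/
def spaceVtx (G : SquareGluing F) : G.Space → Set G.Vtx :=
  Quot.lift G.vtxAt fun _ _ => vtxAt_eq_of_pointRel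

theorem mem_spaceVtx_sideMap {s : F × Fin 4} {t : I} {v : G.Vtx} :
    v ∈ G.spaceVtx (G.sideMap s t) ↔ (t = 0 ∧ G.vtx s = v) ∨ (t = 1 ∧ G.vtx (next s) = v) :=
  mem_vtxAt_sidePoint

theorem vertex_eq_iff {c c' : F × Fin 4} : G.vertex c = G.vertex c' ↔ G.vtx c = G.vtx c' := by
  refine ⟨fun h => ?_, fun h => ?_⟩
  · have hmem : G.vtx c' ∈ G.spaceVtx (G.vertex c) := h ▸ mem_spaceVtx_sideMap.2 (.inl ⟨rfl, rfl⟩)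
    simpa [vertex, mem_spaceVtx_sideMap] using hmem
  · refine congrArg (Quot.lift G.vertex ?_) h
    rintro ⟨f, i⟩ - ⟨⟨g, j⟩, hs, rfl⟩
    refine (Quot.sound (.glue f g i j hs 0)).trans ?_
    rw [unitInterval.symm_zero, sidePoint_one]
    rfl

/-- No side that starts at the combinatorial vertex `v` is unglued. -/
def IsInterior (v : G.Vtx) : Prop := ∀ c, G.vtx c = v → G.mate c ≠ none

theorem sameCycle_turn_of_vtx_eq {c c' : F × Fin 4} (h : G.vtx c = G.vtx c') :
    G.turn.SameCycle c c' := by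
  refine cast (congrArg (Quot.lift (G.turn.SameCycle c) ?_) h) (.refl _ _)
  rintro d - ⟨s, hs, rfl⟩
  exact propext (turn_of_mate hs ▸ Equiv.Perm.sameCycle_apply_right.symm)

theorem IsInterior.vtx_turn {c : F × Fin 4} (hc : IsInterior (G.vtx c)) :
    G.vtx (G.turn c) = G.vtx c := by
  obtain ⟨s, hs⟩ := Option.ne_none_iff_exists'.1 (hc c rfl)
  rw [turn_of_mate hs, vtx_next_of_mate hs]

theorem IsInterior.vtx_iterate_turn {c : F × Fin 4} (hc : IsInterior (G.vtx c)) (k : ℕ) :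
    G.vtx (G.turn^[k] c) = G.vtx c := by
  induction k with
  | zero => rfl
  | succ k ih => rw [iterate_succ_apply', IsInterior.vtx_turn (by rwa [ih]), ih]

variable [Finite F]

theorem IsInterior.vtx_eq_iff {c c' : F × Fin 4} (hc : IsInterior (G.vtx c)) :
    G.vtx c' = G.vtx c ↔ ∃ k < minimalPeriod G.turn c, G.turn^[k] c = c' := by
  refine ⟨fun h => ?_, fun ⟨k, _, hk⟩ => hk ▸ hc.vtx_iterate_turn k⟩
  obtain ⟨k, hk⟩ := (sameCycle_turn_of_vtx_eq h.symm).exists_nat_pow_eq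
  refine ⟨k % minimalPeriod G.turn c, Nat.mod_lt k ?_, ?_⟩
  · exact minimalPeriod_pos_of_mem_periodicPts (G.turn.injective.mem_periodicPts c)
  · rw [iterate_mod_minimalPeriod_eq, ← hk, Equiv.Perm.coe_pow]

theorem not_isInterior_vtx_next {s : F × Fin 4} (hs : G.mate s = none) :
    ¬ IsInterior (G.vtx (next s)) := by
  intro hinterior
  rw [← turn_of_mate_eq_none hs] at hinterior
  obtain ⟨k, hk⟩ : ∃ k : ℕ, (G.turn ^ k) (G.turn s) = s :=
    (Equiv.Perm.sameCycle_apply_left.2 (.refl _ _)).exists_nat_pow_eq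
  refine hinterior s ?_ hs
  rw [← hinterior.vtx_iterate_turn k, ← Equiv.Perm.coe_pow, hk]

theorem IsInterior.vertex_notMem_boundary {c : F × Fin 4} (hc : IsInterior (G.vtx c)) :
    G.vertex c ∉ G.boundary := by
  rintro ⟨s, t, hs, hst⟩
  have hmem : G.vtx c ∈ G.spaceVtx (G.sideMap s t) := hst ▸ mem_spaceVtx_sideMap.2 (.inl ⟨rfl, rfl⟩)
  obtain ⟨-, hvtx⟩ | ⟨-, hvtx⟩ := mem_spaceVtx_sideMap.1 hmem
  · exact hc s hvtx hs
  · exact not_isInterior_vtx_next hs (hvtx ▸ hc)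

theorem isInterior_vtx_of_iterate_turn {c : F × Fin 4}
    (hc : ∀ k, G.mate (G.turn^[k] c) ≠ none) : IsInterior (G.vtx c) := by
  intro c' h
  obtain ⟨k, hk⟩ := (sameCycle_turn_of_vtx_eq h.symm).exists_nat_pow_eq
  rw [← hk, Equiv.Perm.coe_pow]
  exact hc k

theorem IsInterior.setOf_vtx_eq {c : F × Fin 4} (hc : IsInterior (G.vtx c)) :
    {c' | G.vtx c' = G.vtx c} =
      (fun k => G.turn^[k] c) '' Set.Iio (minimalPeriod G.turn c) := by
  ext c'
  simp [hc.vtx_eq_iff]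

theorem IsQuadriculatedDisk.minimalPeriod_turn (hG : G.IsQuadriculatedDisk) {c : F × Fin 4}
    (hc : IsInterior (G.vtx c)) : minimalPeriod G.turn c = 4 := by
  have := hG.four c hc.vertex_notMem_boundary
  simp only [vertex_eq_iff] at this
  rwa [hc.setOf_vtx_eq, iterate_injOn_Iio_minimalPeriod.ncard_image, Set.ncard_Iio_nat] at this

/-- The sum over the corners at each combinatorial vertex. -/
noncomputable def cornerSum (G : SquareGluing F) (A : Type*) [AddCommGroup A] :
    (F × Fin 4 → A) →ₗ[ℤ] G.Vtx → A :=
  FunOnFinite.linearMap ℤ A G.vtx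

theorem IsInterior.cornerSum_vtx {A : Type*} [AddCommGroup A] {c : F × Fin 4}
    (hc : IsInterior (G.vtx c)) (φ : F × Fin 4 → A) :
    G.cornerSum A φ (G.vtx c) = birkhoffSum G.turn φ (minimalPeriod G.turn c) c := by
  classical
  cases nonempty_fintype F
  have himage : ({c' | G.vtx c' = G.vtx c} : Finset (F × Fin 4)) =
      (Finset.range (minimalPeriod G.turn c)).image fun k => G.turn^[k] c :=
    Finset.coe_injective (by simpa using hc.setOf_vtx_eq)
  rw [cornerSum, FunOnFinite.linearMap_apply_apply, himage, Finset.sum_image, birkhoffSum]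
  simpa using iterate_injOn_Iio_minimalPeriod

end Vertices

section Potentials

variable {F : Type*} {G : SquareGluing F}

theorem exists_next_sub_eq {A : Type*} [AddCommGroup A] {z : F × Fin 4 → A}
    (hz : ∀ f, ∑ i, z (f, i) = 0) : ∃ p : F × Fin 4 → A, ∀ s, p (next s) - p s = z s := by
  refine ⟨fun s => ![0, z (s.1, 0), z (s.1, 0) + z (s.1, 1), -z (s.1, 3)] s.2, fun ⟨f, i⟩ => ?_⟩
  have := hz f
  rw [Fin.sum_univ_four] at this
  fin_cases i <;> simp [next_apply, eq_neg_of_add_eq_zero_right this]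

theorem sub_comp_flip_mem_antisymm {A : Type*} [AddCommGroup A] (φ : F × Fin 4 → A) :
    φ - φ ∘ G.flip ∈ G.antisymm A := fun s s' h => by
  simp [flip_of_mate h, flip_of_mate (G.mate_symm _ _ h)]

theorem single_mem_antisymm [DecidableEq F] {s : F × Fin 4} (hs : G.mate s = none) :
    Pi.single s 1 ∈ G.antisymm ℤ := fun s₁ s₂ h => by
  have h₁ : s₁ ≠ s := by
    rintro rfl
    exact absurd (h.symm.trans hs) (Option.some_ne_none _)
  have h₂ : s₂ ≠ s := by
    rintro rfl
    exact absurd ((G.mate_symm _ _ h).symm.trans hs) (Option.some_ne_none _)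
  simp [h₁, h₂]

theorem exists_antisymm_cast_eq {color : F → Bool} (hcolor : G.IsBicoloring color) {n : ℕ}
    {t : F × Fin 4 → ZMod n} (ht : t ∈ G.antisymm (ZMod n)) :
    ∃ t₀ ∈ G.antisymm ℤ, ∀ s, (t₀ s : ZMod n) = t s := by
  refine ⟨fun s => if color s.1 then (t s).cast else -(-t s).cast, fun s s' h => ?_, fun s => ?_⟩
  · have hc : color s.1 ≠ color s'.1 := hcolor _ _ ⟨s.2, s'.2, h⟩
    cases h₁ : color s.1 <;> cases h₂ : color s'.1 <;> simp_all [ht s s' h]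
  · dsimp only
    split_ifs <;> simp

theorem sum_eq_zero_of_mem_antisymm [Fintype F] {t : F × Fin 4 → ℤ} (ht : t ∈ G.antisymm ℤ)
    (hmate : ∀ s, G.mate s ≠ none) : ∑ s, t s = 0 := by
  have hflip (s : F × Fin 4) : t (G.flip s) = -t s := by
    obtain ⟨s', h⟩ := Option.ne_none_iff_exists'.1 (hmate s)
    rw [flip_of_mate h, ht s s' h]
  have := Equiv.sum_comp G.flip t
  simp only [hflip, Finset.sum_neg_distrib] at this
  linarith

variable [Finite F]

theorem IsQuadriculatedDisk.exists_potential (hG : G.IsQuadriculatedDisk) {t : F × Fin 4 → ℤ}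
    (ht : t ∈ G.antisymm ℤ) (hsum : ∀ v, IsInterior v → G.cornerSum ℤ t v = 0) :
    ∃ τ : F → ℤ, ∀ s s', G.mate s = some s' → τ s.1 - τ s'.1 = t s := by
  obtain ⟨a, ha⟩ := exists_sub_apply_eq_of_notMem (f := G.turn) (t := fun s => (t s : ℝ))
    (D := {s | G.mate s = none}) G.turn.injective.mem_periodicPts fun c hc => by
      have hinterior := isInterior_vtx_of_iterate_turn hc
      change birkhoffSum G.turn (Int.castRingHom ℝ ∘ t) _ c = 0
      rw [← map_birkhoffSum, ← hinterior.cornerSum_vtx, hsum _ hinterior, map_zero]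
  exact hG.exists_potential_of_corner ht fun s s' h => by
    rw [← turn_of_mate h, ha s (by simp [h])]

theorem IsQuadriculatedDisk.exists_vtx_potential (hG : G.IsQuadriculatedDisk) {z : F × Fin 4 → ℤ}
    (hz : z ∈ G.antisymm ℤ) (hsum : ∀ f, ∑ i, z (f, i) = 0) :
    ∃ u : G.Vtx → ℤ, ∀ s, u (G.vtx (next s)) - u (G.vtx s) = z s := by
  obtain ⟨p, hp⟩ := exists_next_sub_eq hsum
  have ht : p - p ∘ G.turn ∈ G.antisymm ℤ := fun s s' h => by
    have := hz s s' h
    simp only [Pi.sub_apply, comp_apply, turn_of_mate h, turn_of_mate (G.mate_symm _ _ h)]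
    linarith [hp s, hp s']
  obtain ⟨τ, hτ⟩ := hG.exists_potential ht fun v hv => by
    obtain ⟨c, rfl⟩ := vtx_surjective v
    rw [hv.cornerSum_vtx, birkhoffSum_sub_comp, iterate_minimalPeriod, sub_self]
  refine ⟨Quot.lift (fun s => p s - τ s.1) ?_, fun s => ?_⟩
  · rintro s - ⟨s', h, rfl⟩
    have := hτ s s' h
    simp only [Pi.sub_apply, comp_apply, turn_of_mate h] at this
    change _ = p (next s') - τ s'.1
    linarith
  · change p (next s) - τ s.1 - (p s - τ s.1) = z s
    rw [sub_sub_sub_cancel_right, hp]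

theorem single_vtx_mem_map_cornerSum [DecidableEq G.Vtx] {s : F × Fin 4} (hs : G.mate s = none) :
    Pi.single (G.vtx s) 1 ∈ (G.antisymm ℤ).map (G.cornerSum ℤ) := by
  classical
  exact Submodule.mem_map.2 ⟨_, single_mem_antisymm hs, by simp [cornerSum]⟩

theorem single_vtx_next_mem_map_cornerSum [DecidableEq G.Vtx] {s : F × Fin 4}
    (hs : G.mate s = none) : Pi.single (G.vtx (next s)) 1 ∈ (G.antisymm ℤ).map (G.cornerSum ℤ) := by
  have := not_isInterior_vtx_next hs
  simp only [IsInterior, not_forall, not_not] at this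
  obtain ⟨c, hc, hnone⟩ := this
  exact hc ▸ single_vtx_mem_map_cornerSum hnone

theorem single_vtx_sub_single_vtx_next_mem_map_cornerSum [DecidableEq G.Vtx] (s : F × Fin 4) :
    Pi.single (G.vtx s) 1 - Pi.single (G.vtx (next s)) 1 ∈
      (G.antisymm ℤ).map (G.cornerSum ℤ) := by
  classical
  cases h : G.mate s with
  | none => exact sub_mem (single_vtx_mem_map_cornerSum h) (single_vtx_next_mem_map_cornerSum h)
  | some s' =>
    refine Submodule.mem_map.2 ⟨_, sub_comp_flip_mem_antisymm (Pi.single s 1), ?_⟩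
    have hflip : (Pi.single s 1 : F × Fin 4 → ℤ) ∘ G.flip = Pi.single s' 1 := by
      ext x
      have hx : G.flip x = s ↔ x = s' := by
        rw [← flip_of_mate h]
        exact (Equiv.eq_symm_apply G.flip).symm
      simp only [Pi.single_apply, comp_apply, hx]
    rw [hflip, vtx_next_of_mate (G.mate_symm _ _ h)]
    simp [cornerSum]

theorem IsQuadriculatedDisk.single_sub_single_mem_map_cornerSum [DecidableEq G.Vtx]
    (hG : G.IsQuadriculatedDisk) (v w : G.Vtx) :
    Pi.single v 1 - Pi.single w 1 ∈ (G.antisymm ℤ).map (G.cornerSum ℤ) := by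
  obtain ⟨c, rfl⟩ := vtx_surjective v
  obtain ⟨c', rfl⟩ := vtx_surjective w
  refine hG.side_induction (s := c) (P := fun c' => Pi.single (G.vtx c) 1 -
    Pi.single (G.vtx c') 1 ∈ (G.antisymm ℤ).map (G.cornerSum ℤ)) (fun s hs => ?_)
    (fun s s' h hs => ?_) (by simp) c'
  · simpa only [sub_add_sub_cancel] using
      add_mem hs (single_vtx_sub_single_vtx_next_mem_map_cornerSum s)
  · rw [← vtx_next_of_mate (G.mate_symm _ _ h)]
    simpa only [sub_add_sub_cancel] using
      add_mem hs (single_vtx_sub_single_vtx_next_mem_map_cornerSum s)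

theorem IsQuadriculatedDisk.mem_map_cornerSum [Fintype G.Vtx] (hG : G.IsQuadriculatedDisk)
    {m : G.Vtx → ℤ} (hm : (∀ v : G.Vtx, IsInterior v) → ∑ v, m v = 0) :
    m ∈ (G.antisymm ℤ).map (G.cornerSum ℤ) := by
  classical
  by_cases hinterior : ∀ v : G.Vtx, IsInterior v
  · refine mem_of_funOnFinite_linearMap_eq_zero (q := fun _ => ())
      (fun v w _ => hG.single_sub_single_mem_map_cornerSum v w) (funext fun _ => ?_)
    simpa [FunOnFinite.linearMap_apply_apply] using hm hinterior
  · simp only [IsInterior, not_forall, not_not] at hinterior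
    obtain ⟨_, c, rfl, hc⟩ := hinterior
    have hsingle (v : G.Vtx) : Pi.single v 1 ∈ (G.antisymm ℤ).map (G.cornerSum ℤ) := by
      simpa using add_mem (hG.single_sub_single_mem_map_cornerSum v (G.vtx c))
        (single_vtx_mem_map_cornerSum hc)
    rw [pi_eq_sum_univ' m]
    exact sum_mem fun v _ => Submodule.smul_mem _ _ (hsingle v)

theorem IsQuadriculatedDisk.exists_potential_zmod (hG : G.IsQuadriculatedDisk)
    {color : F → Bool} (hcolor : G.IsBicoloring color) {n : ℕ} [NeZero n]
    {t : F × Fin 4 → ZMod n} (ht : t ∈ G.antisymm (ZMod n))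
    (hsum : ∀ v, IsInterior v → G.cornerSum (ZMod n) t v = 0) :
    ∃ τ : F → ZMod n, ∀ s s', G.mate s = some s' → τ s.1 - τ s'.1 = t s := by
  classical
  cases nonempty_fintype F
  cases nonempty_fintype G.Vtx
  obtain ⟨t₀, ht₀, hcast⟩ := exists_antisymm_cast_eq hcolor ht
  have hdvd (v) (hv : IsInterior v) : (n : ℤ) ∣ G.cornerSum ℤ t₀ v := by
    rw [← ZMod.intCast_zmod_eq_zero_iff_dvd, ← hsum v hv]
    simp [cornerSum, FunOnFinite.linearMap_apply_apply, hcast]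
  obtain ⟨t₁, ht₁, hsum₁⟩ := Submodule.mem_map.1 <|
    hG.mem_map_cornerSum (m := fun v => G.cornerSum ℤ t₀ v / n) fun hinterior => by
      refine (mul_eq_zero.1 ?_).resolve_left (Nat.cast_ne_zero.2 (NeZero.ne n))
      simp only [Finset.mul_sum, Int.mul_ediv_cancel' (hdvd _ (hinterior _))]
      rw [cornerSum, sum_funOnFinite_linearMap]
      exact sum_eq_zero_of_mem_antisymm ht₀ fun s => hinterior _ s rfl
  obtain ⟨τ, hτ⟩ := hG.exists_potential (sub_mem ht₀ (Submodule.smul_mem _ (n : ℤ) ht₁))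
    fun v hv => by
      rw [map_sub, map_smul, hsum₁]
      simp [Int.mul_ediv_cancel' (hdvd v hv)]
  refine ⟨fun f => τ f, fun s s' h => ?_⟩
  rw [← hcast, ← Int.cast_sub, hτ s s' h]
  simp

end Potentials

section Directions

variable {F : Type*} {G : SquareGluing F}

/-- Directions of the squares of a surface: side `i` of the square `f` points in the direction
`r f + i` (counted in quarter turns), and glued sides point in opposite directions. -/
def IsDirection (G : SquareGluing F) (r : F → Fin 4) : Prop :=
  ∀ s s', G.mate s = some s' → r s'.1 + s'.2 = r s.1 + s.2 + 2

variable {r : F → Fin 4}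

theorem IsDirection.turn_eq (hr : G.IsDirection r) {c : F × Fin 4} (hc : G.mate c ≠ none) :
    r (G.turn c).1 + (G.turn c).2 = r c.1 + c.2 + 3 := by
  obtain ⟨s, hs⟩ := Option.ne_none_iff_exists'.1 hc
  rw [turn_of_mate hs, next_apply, ← add_assoc, hr c s hs, add_assoc]
  rfl

theorem IsDirection.iterate_turn_eq (hr : G.IsDirection r) {c : F × Fin 4}
    (hc : IsInterior (G.vtx c)) (k : ℕ) :
    r (G.turn^[k] c).1 + (G.turn^[k] c).2 = r c.1 + c.2 + k • 3 := by
  induction k with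
  | zero => simp
  | succ k ih =>
    rw [iterate_succ_apply', hr.turn_eq (hc _ (hc.vtx_iterate_turn k)), ih, succ_nsmul, add_assoc]

variable [Finite F]

theorem IsQuadriculatedDisk.exists_isDirection (hG : G.IsQuadriculatedDisk) {color : F → Bool}
    (hcolor : G.IsBicoloring color) : ∃ r, G.IsDirection r := by
  have hfour : (4 : ZMod 4) = 0 := rfl
  let u : F × Fin 4 → ZMod 4 := Prod.snd
  have hu (s : F × Fin 4) : u (next s) = u s + 1 := rfl
  obtain ⟨τ, hτ⟩ := hG.exists_potential_zmod hcolor (t := (u - u ∘ G.turn) + fun _ => 3)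
    (fun s s' h => by
      simp only [Pi.add_apply, Pi.sub_apply, comp_apply, turn_of_mate h,
        turn_of_mate (G.mate_symm _ _ h), hu]
      linear_combination hfour)
    fun v hv => by
      obtain ⟨c, rfl⟩ := vtx_surjective v
      rw [map_add, Pi.add_apply, hv.cornerSum_vtx, hv.cornerSum_vtx, birkhoffSum_sub_comp,
        iterate_minimalPeriod, sub_self, hG.minimalPeriod_turn hv, zero_add]
      rfl
  refine ⟨fun f => -τ f, fun s s' h => ?_⟩
  change -τ s'.1 + u s' = -τ s.1 + u s + 2
  have := hτ s s' h
  simp only [Pi.add_apply, Pi.sub_apply, comp_apply, turn_of_mate h, hu] at this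
  linear_combination this

theorem IsDirection.exists_coordinate (hr : G.IsDirection r) (hG : G.IsQuadriculatedDisk)
    {X : Fin 4 → ℤ} (hX : ∀ d, X (d + 2) = -X d) :
    ∃ x : F → ℤ, ∀ s s', G.mate s = some s' → x s.1 - x s'.1 = X (r s.1 + s.2) := by
  refine hG.exists_potential (t := fun s => X (r s.1 + s.2))
    (fun s s' h => by simp only [hr s s' h, hX]) fun v hv => ?_
  obtain ⟨c, rfl⟩ := vtx_surjective v
  simp only [hv.cornerSum_vtx, birkhoffSum, hG.minimalPeriod_turn hv, hr.iterate_turn_eq hv]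
  generalize r c.1 + c.2 = d
  have h₀ := hX d
  have h₁ := hX (d + 1)
  rw [add_assoc] at h₁
  simp only [Finset.sum_range_succ, Finset.sum_range_zero, zero_nsmul, add_zero]
  change _ + X (d + 3) + X (d + 2) + X (d + 1) = 0
  change X (d + 3) = _ at h₁
  linarith

theorem IsQuadriculatedDisk.exists_mate_eq_none (hG : G.IsQuadriculatedDisk) {color : F → Bool}
    (hcolor : G.IsBicoloring color) : ∃ s, G.mate s = none := by
  obtain ⟨r, hr⟩ := hG.exists_isDirection hcolor
  obtain ⟨x, hx⟩ := hr.exists_coordinate hG (X := ![0, 1, 0, -1]) (by decide)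
  have := hG.nonempty
  obtain ⟨f, hf⟩ := Finite.exists_max x
  refine ⟨(f, 3 - r f), Option.eq_none_iff_forall_ne_some.2 fun s' h => ?_⟩
  have hlt := hx _ _ h
  rw [add_sub_cancel] at hlt
  change _ = -1 at hlt
  linarith [hf s'.1]

theorem IsQuadriculatedDisk.side_unique (hG : G.IsQuadriculatedDisk) {color : F → Bool}
    (hcolor : G.IsBicoloring color) {s s' a a' : F × Fin 4} (hs : G.mate s = some a)
    (hs' : G.mate s' = some a') (h₁ : s.1 = s'.1) (h₂ : a.1 = a'.1) : s = s' := by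
  obtain ⟨r, hr⟩ := hG.exists_isDirection hcolor
  obtain ⟨x, hx⟩ := hr.exists_coordinate hG (X := ![0, 1, 0, -1]) (by decide)
  obtain ⟨y, hy⟩ := hr.exists_coordinate hG (X := ![-1, 0, 1, 0]) (by decide)
  have hinj : ∀ d e : Fin 4, (![0, 1, 0, -1] : Fin 4 → ℤ) d = (![0, 1, 0, -1] : Fin 4 → ℤ) e →
      (![-1, 0, 1, 0] : Fin 4 → ℤ) d = (![-1, 0, 1, 0] : Fin 4 → ℤ) e → d = e := by decide
  have hdir := hinj (r s.1 + s.2) (r s'.1 + s'.2) (by rw [← hx _ _ hs, ← hx _ _ hs', h₁, h₂])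
    (by rw [← hy _ _ hs, ← hy _ _ hs', h₁, h₂])
  rw [h₁] at hdir
  exact Prod.ext h₁ (add_left_cancel hdir)

theorem IsQuadriculatedDisk.exists_sign (hG : G.IsQuadriculatedDisk) {color : F → Bool}
    (hcolor : G.IsBicoloring color) :
    ∃ ε κ : F → ℤˣ, ∀ s s', G.mate s = some s' → ε s'.1 = κ s.1 * (-1) ^ (s.2 : ℕ) := by
  obtain ⟨r, hr⟩ := hG.exists_isDirection hcolor
  -- The signs alternate with the rows of squares.
  let X : Fin 4 → ℤ := ![-1, 0, 1, 0]
  obtain ⟨y, hy⟩ := hr.exists_coordinate hG (X := X) (by decide)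
  have hX : ∀ d i : Fin 4, (X (d + i)).negOnePow = (X d).negOnePow * (-1) ^ (i : ℕ) := by decide
  refine ⟨fun f => (y f).negOnePow, fun f => (y f).negOnePow * (X (r f)).negOnePow,
    fun s s' h => ?_⟩
  rw [mul_assoc, ← hX, ← hy s s' h, ← Int.negOnePow_add, Int.negOnePow_eq_iff]
  exact ⟨y s'.1 - y s.1, by ring⟩

end Directions

section CornerDiff

variable {F : Type*} {G : SquareGluing F}

/-- The difference at each corner of the values of a function on sides, from the side that ends at
the corner to the side that starts there. -/
def cornerDiff : (F × Fin 4 → ℤ) →ₗ[ℤ] F × Fin 4 → ℤ :=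
  LinearMap.funLeft ℤ ℤ next.symm - LinearMap.id

theorem cornerDiff_apply (y : F × Fin 4 → ℤ) (s : F × Fin 4) :
    cornerDiff y s = y (next.symm s) - y s := rfl

theorem cornerDiff_next (y : F × Fin 4 → ℤ) (s : F × Fin 4) :
    cornerDiff y (next s) = y s - y (next s) := by
  rw [cornerDiff_apply, Equiv.symm_apply_apply]

theorem sum_mul_cornerDiff [Fintype F] (a y : F × Fin 4 → ℤ) :
    ∑ s, a s * cornerDiff y s = ∑ s, (a (next s) - a s) * y s := by
  simp only [cornerDiff_apply, mul_sub, sub_mul, Finset.sum_sub_distrib]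
  rw [← Equiv.sum_comp next fun s => a s * y (next.symm s)]
  simp only [Equiv.symm_apply_apply]

theorem flip_flip (s : F × Fin 4) : G.flip (G.flip s) = s := Involutive.toPerm_involutive _ s

theorem sum_mul_eq_zero_of_flip [Fintype F] {y z : F × Fin 4 → ℤ}
    (hy : ∀ s, y (G.flip s) = y s) (hz : ∀ s, z (G.flip s) = -z s) : ∑ s, z s * y s = 0 := by
  have := Equiv.sum_comp G.flip fun s => z s * y s
  simp only [hy, hz, neg_mul, Finset.sum_neg_distrib] at this
  linarith

theorem sum_single_apply [DecidableEq F] (s : F × Fin 4) (f : F) :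
    ∑ i, (Pi.single s 1 : F × Fin 4 → ℤ) (f, i) = (Pi.single s.1 1 : F → ℤ) f := by
  by_cases hs : f = s.1 <;> simp [Pi.single_apply, Prod.ext_iff, hs]

theorem IsQuadriculatedDisk.exists_sum_eq_single_sub_single [DecidableEq F]
    (hG : G.IsQuadriculatedDisk) (f g : F) :
    ∃ z : F × Fin 4 → ℤ, (∀ s, z (G.flip s) = -z s) ∧
      ∀ f', ∑ i, z (f', i) = (Pi.single f 1 - Pi.single g 1 : F → ℤ) f' := by
  refine hG.side_induction (s := (g, 0)) (P := fun s => ∃ z : F × Fin 4 → ℤ,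
    (∀ s, z (G.flip s) = -z s) ∧
      ∀ f', ∑ i, z (f', i) = (Pi.single s.1 1 - Pi.single g 1 : F → ℤ) f') (fun _ hs => hs)
    ?_ ⟨0, by simp, by simp⟩ (f, 0)
  rintro s s' h ⟨z, hz, hsum⟩
  have hflip (x : F × Fin 4) : (Pi.single s' 1 : F × Fin 4 → ℤ) (G.flip x) =
      (Pi.single s 1 : F × Fin 4 → ℤ) x := by
    simp only [Pi.single_apply, ← flip_of_mate h, EmbeddingLike.apply_eq_iff_eq]
  have hflip' (x : F × Fin 4) : (Pi.single s 1 : F × Fin 4 → ℤ) (G.flip x) =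
      (Pi.single s' 1 : F × Fin 4 → ℤ) x := by
    rw [← hflip, flip_flip]
  refine ⟨z + (Pi.single s' 1 - Pi.single s 1), fun x => ?_, fun f' => ?_⟩
  · simp only [Pi.add_apply, Pi.sub_apply, hz, hflip, hflip']
    ring
  · simp only [Pi.add_apply, Pi.sub_apply, Finset.sum_add_distrib, Finset.sum_sub_distrib, hsum,
      sum_single_apply]
    ring

variable [Finite F]

theorem cornerSum_cornerDiff {y : F × Fin 4 → ℤ} (hy : ∀ s, y (G.flip s) = y s)
    (hy_zero : ∀ s, G.mate s = none → y s = 0) : G.cornerSum ℤ (cornerDiff y) = 0 := by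
  classical
  cases nonempty_fintype F
  change G.cornerSum ℤ (y ∘ next.symm - y) = 0
  rw [map_sub, sub_eq_zero]
  ext v
  have hcomp := Equiv.sum_comp G.turn fun s => if G.vtx s = v then y (next.symm s) else 0
  simp only [turn_apply, Equiv.symm_apply_apply, hy] at hcomp
  simp only [cornerSum, FunOnFinite.linearMap_apply_apply, Finset.sum_filter, comp_apply, ← hcomp]
  refine Finset.sum_congr rfl fun s _ => ?_
  cases h : G.mate s with
  | none => simp [hy_zero s h]
  | some s' => rw [flip_of_mate h, vtx_next_of_mate h]

theorem IsQuadriculatedDisk.eq_of_mate_eq_none (hG : G.IsQuadriculatedDisk)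
    {y : F × Fin 4 → ℤ} (hy : ∀ s, y (G.flip s) = y s) (hsum : G.cornerSum ℤ (cornerDiff y) = 0)
    {s s' : F × Fin 4} (hs : G.mate s = none) (hs' : G.mate s' = none) : y s = y s' := by
  classical
  cases nonempty_fintype F
  cases nonempty_fintype G.Vtx
  obtain ⟨z, hz, hzsum⟩ := hG.exists_sum_eq_single_sub_single s'.1 s.1
  have hz_mem : z ∈ G.antisymm ℤ := fun s s' h => by rw [← flip_of_mate h, hz]
  obtain ⟨u, hu⟩ := hG.exists_vtx_potential (z := z + Pi.single s 1 - Pi.single s' 1)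
    (sub_mem (add_mem hz_mem (single_mem_antisymm hs)) (single_mem_antisymm hs')) fun f => by
      simp only [Pi.sub_apply, Pi.add_apply, Finset.sum_sub_distrib, Finset.sum_add_distrib, hzsum,
        sum_single_apply]
      ring
  have hpair := sum_smul_funOnFinite_linearMap G.vtx u (cornerDiff y)
  change ∑ v, u v • G.cornerSum ℤ (cornerDiff y) v = _ at hpair
  simp only [smul_eq_mul, sum_mul_cornerDiff, hsum, hu, Pi.zero_apply, mul_zero,
    Finset.sum_const_zero, Pi.sub_apply, Pi.add_apply, sub_mul, add_mul, Finset.sum_sub_distrib,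
    Finset.sum_add_distrib, sum_mul_eq_zero_of_flip hy hz, zero_add] at hpair
  simp only [Pi.single_apply, ite_mul, one_mul, zero_mul, Finset.sum_ite_eq', Finset.mem_univ,
    if_true] at hpair
  linarith

theorem IsQuadriculatedDisk.exists_flip_invariant_cornerDiff_eq (hG : G.IsQuadriculatedDisk)
    {c : F × Fin 4 → ℤ} (hc : ∀ f, ∑ i, c (f, i) = 0) (hsum : G.cornerSum ℤ c = 0) :
    ∃ y : F × Fin 4 → ℤ, (∀ s, y (G.flip s) = y s) ∧ cornerDiff y = c := by
  obtain ⟨p, hp⟩ := exists_next_sub_eq hc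
  obtain ⟨τ, hτ⟩ := hG.exists_potential (t := c + (p - p ∘ G.turn))
    (fun s s' h => by
      simp only [Pi.add_apply, Pi.sub_apply, comp_apply, turn_of_mate h,
        turn_of_mate (G.mate_symm _ _ h)]
      linarith [hp s, hp s'])
    fun v hv => by
      obtain ⟨c, rfl⟩ := vtx_surjective v
      rw [map_add, hsum, zero_add, hv.cornerSum_vtx, birkhoffSum_sub_comp, iterate_minimalPeriod,
        sub_self]
  refine ⟨fun s => τ s.1 - p (next s), fun s => ?_, funext fun s => ?_⟩
  · cases h : G.mate s with
    | none => rw [flip_of_mate_eq_none h]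
    | some s' =>
      have := hτ s s' h
      simp only [Pi.add_apply, Pi.sub_apply, comp_apply, turn_of_mate h] at this
      rw [flip_of_mate h]
      linarith [hp s]
  · obtain ⟨s, rfl⟩ := next.surjective s
    have : τ (next s).1 = τ s.1 := rfl
    rw [cornerDiff_next]
    linarith [hp (next s)]

theorem IsQuadriculatedDisk.exists_cornerDiff_eq (hG : G.IsQuadriculatedDisk)
    {c : F × Fin 4 → ℤ} (hc : ∀ f, ∑ i, c (f, i) = 0) (hsum : G.cornerSum ℤ c = 0) :
    ∃ y : F × Fin 4 → ℤ, (∀ s, y (G.flip s) = y s) ∧ (∀ s, G.mate s = none → y s = 0) ∧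
      cornerDiff y = c := by
  obtain ⟨y, hy, rfl⟩ := hG.exists_flip_invariant_cornerDiff_eq hc hsum
  obtain ⟨k, hk⟩ : ∃ k, ∀ s, G.mate s = none → y s = k := by
    by_cases h : ∃ e, G.mate e = none
    · obtain ⟨e, he⟩ := h
      exact ⟨y e, fun s hs => hG.eq_of_mate_eq_none hy hsum hs he⟩
    · exact ⟨0, fun s hs => (h ⟨s, hs⟩).elim⟩
  refine ⟨fun s => y s - k, fun s => by simp only [hy], fun s hs => sub_eq_zero.2 (hk s hs), ?_⟩
  ext s
  exact sub_sub_sub_cancel_right _ _ k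

end CornerDiff

section Lift

variable {F : Type*} {G : SquareGluing F} {color : F → Bool} {n : ℤ}

/-- The functions on sides that encode functions on the white squares whose neighbor sums, twisted
by the signs of `IsQuadriculatedDisk.exists_sign`, vanish modulo `n`: a side of a white square
carries the value of the square, an unglued side of a black square carries `0`. -/
structure IsTwistedKernel (G : SquareGluing F) (color : F → Bool) (n : ℤ) (y : F × Fin 4 → ℤ) :
    Prop where
  flip s : y (G.flip s) = y s
  black_zero s : color s.1 = true → G.mate s = none → y s = 0
  white_const s : color s.1 = false → y (next s) = y s
  dvd_sum f : color f = true → n ∣ ∑ i : Fin 4, (-1) ^ (i : ℕ) * y (f, i)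

/-- The corner to which a corner is joined by an edge of the graph on the vertices that carries
the flows: the opposite corner of a black square, the next corner of a white square. -/
def partner (color : F → Bool) : Equiv.Perm (F × Fin 4) :=
  Equiv.prodShear (Equiv.refl F) fun f => Equiv.addRight (if color f then 2 else 1)

theorem partner_symm_of_black {s : F × Fin 4} (hs : color s.1 = true) :
    (partner color).symm s = (s.1, s.2 + 2) := by
  rw [Equiv.symm_apply_eq]
  simp [partner, Equiv.prodShear, hs, add_assoc]

theorem partner_symm_of_white {s : F × Fin 4} (hs : color s.1 = false) :
    (partner color).symm s = next.symm s := by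
  obtain ⟨s, rfl⟩ := next.surjective s
  rw [Equiv.symm_apply_eq, Equiv.symm_apply_apply]
  simp only [next_apply] at hs ⊢
  simp [partner, Equiv.prodShear, hs]

/-- The restriction of a function on sides to the sides of white squares, extended by `0`. -/
def whitePart (color : F → Bool) (ψ : F × Fin 4 → ℤ) (s : F × Fin 4) : ℤ :=
  if color s.1 then 0 else ψ s

theorem sum_sub_partner_symm (ψ : F × Fin 4 → ℤ) (f : F) :
    ∑ i, (ψ - ψ ∘ (partner color).symm) (f, i) = 0 := by
  have := (Equiv.addRight (if color f then 2 else 1 : Fin 4)).symm.sum_comp fun i => ψ (f, i)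
  simp only [Pi.sub_apply, Finset.sum_sub_distrib, sub_eq_zero]
  exact this.symm

theorem dvd_of_dvd_cornerDiff (hG : G.IsQuadriculatedDisk) {y : F × Fin 4 → ℤ}
    (hy : ∀ s, y (G.flip s) = y s) (hdvd : ∀ s, n ∣ cornerDiff y s) {s : F × Fin 4}
    (hs : n ∣ y s) (s' : F × Fin 4) : n ∣ y s' := by
  refine hG.side_induction (P := fun s => n ∣ y s) (fun s hs => ?_) (fun s s' h hs => ?_) hs s'
  · exact (dvd_sub_right hs).1 (cornerDiff_next y s ▸ hdvd (next s))
  · rwa [← flip_of_mate h, hy]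

theorem cornerDiff_add_cornerDiff (y : F × Fin 4 → ℤ) (f : F) (i : Fin 4) :
    cornerDiff y (f, i) + cornerDiff y (f, i + 2) =
      (-1) ^ (i : ℕ) * -∑ j : Fin 4, (-1) ^ (j : ℕ) * y (f, j) := by
  have hd (j : Fin 4) : cornerDiff y (f, j) = y (f, j - 1) - y (f, j) := by
    have : next.symm (f, j) = (f, j - 1) := by simp [Equiv.symm_apply_eq, next_apply]
    rw [cornerDiff_apply, this]
  have hneg : (-1 : Fin 4) = 3 := rfl
  rw [hd, hd, Fin.sum_univ_four]
  fin_cases i <;> simp [hneg] <;> ring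

theorem IsTwistedKernel.dvd_cornerDiff_add {y : F × Fin 4 → ℤ} (hy : G.IsTwistedKernel color n y)
    {s : F × Fin 4} (hs : color s.1 = true) :
    n ∣ cornerDiff y s + cornerDiff y (s.1, s.2 + 2) := by
  rw [cornerDiff_add_cornerDiff y s.1 s.2]
  exact (hy.dvd_sum s.1 hs).neg_right.mul_left _

theorem IsTwistedKernel.cornerDiff_of_white {y : F × Fin 4 → ℤ}
    (hy : G.IsTwistedKernel color n y) {s : F × Fin 4} (hs : color s.1 = false) :
    cornerDiff y s = 0 := by
  obtain ⟨s, rfl⟩ := next.surjective s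
  rw [cornerDiff_next, hy.white_const s hs, sub_self]

theorem IsTwistedKernel.exists_dvd_cornerDiff_sub {y : F × Fin 4 → ℤ}
    (hy : G.IsTwistedKernel color n y) :
    ∃ φ : F × Fin 4 → ℤ, (∀ s, color s.1 = false → G.mate s ≠ none → φ s = 0) ∧
      (∀ s, G.mate s = none → (y - whitePart color φ) s = 0) ∧
      ∀ s, n ∣ (cornerDiff (y - whitePart color φ) - (φ - φ ∘ (partner color).symm)) s := by
  classical
  refine ⟨fun s => if color s.1 then if s.2 < 2 then cornerDiff y s else 0
    else if G.mate s = none then y s else 0, fun s hs h => by simp [hs, h], fun s h => ?_,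
    fun s => ?_⟩
  · cases hs : color s.1 <;> simp [whitePart, hs, h, hy.black_zero s]
  cases hs : color s.1 with
  | false =>
    have hprev : color (next.symm s).1 = false := hs
    simp [hy.cornerDiff_of_white hs, partner_symm_of_white hs, cornerDiff_apply (whitePart _ _),
      whitePart, hs, hprev]
  | true =>
    have hprev : color (next.symm s).1 = true := hs
    have hlt : ∀ i : Fin 4, i + 2 < 2 ↔ ¬ i < 2 := by decide
    by_cases hi : s.2 < 2 <;>
      simp [partner_symm_of_black hs, cornerDiff_apply (whitePart _ _), whitePart, hs, hprev, hlt,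
        hi, hy.dvd_cornerDiff_add hs]

theorem whitePart_flip {ψ : F × Fin 4 → ℤ}
    (hψ : ∀ s, color s.1 = false → G.mate s ≠ none → ψ s = 0) (s : F × Fin 4) :
    whitePart color ψ (G.flip s) = whitePart color ψ s := by
  cases h : G.mate s with
  | none => rw [flip_of_mate_eq_none h]
  | some s' =>
    have hzero (a) (ha : G.mate a ≠ none) : whitePart color ψ a = 0 := by
      cases hc : color a.1 <;> simp [whitePart, hc, hψ a, ha]
    rw [flip_of_mate h, hzero s (by simp [h]), hzero s' (by simp [G.mate_symm _ _ h])]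

theorem isTwistedKernel_add_whitePart {ψ z : F × Fin 4 → ℤ}
    (hψ : ∀ s, color s.1 = false → G.mate s ≠ none → ψ s = 0) (hz : ∀ s, z (G.flip s) = z s)
    (hz_zero : ∀ s, G.mate s = none → z s = 0)
    (hzψ : cornerDiff z = ψ - ψ ∘ (partner color).symm) :
    G.IsTwistedKernel color 0 (z + whitePart color ψ) where
  flip s := by simp only [Pi.add_apply, hz, whitePart_flip hψ]
  black_zero s hs h := by simp [whitePart, hs, hz_zero s h]
  white_const s hs := by
    have hnext : color (next s).1 = false := hs
    have := congrFun hzψ (next s)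
    simp only [cornerDiff_next, Pi.sub_apply, comp_apply, partner_symm_of_white hnext,
      Equiv.symm_apply_apply] at this
    simp only [Pi.add_apply, whitePart, hs, hnext, Bool.false_eq_true, if_false]
    linarith
  dvd_sum f hf := by
    have hsum := cornerDiff_add_cornerDiff z f 0
    simp only [hzψ, Pi.sub_apply, comp_apply, partner_symm_of_black (s := (f, _)) hf] at hsum
    simp [whitePart, hf] at hsum ⊢
    linarith

theorem dvd_cornerSum [Finite F] {φ : F × Fin 4 → ℤ} (hφ : ∀ s, n ∣ φ s) (v : G.Vtx) :
    n ∣ G.cornerSum ℤ φ v := by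
  classical
  cases nonempty_fintype F
  rw [cornerSum, FunOnFinite.linearMap_apply_apply]
  exact Finset.dvd_sum fun s _ => hφ s

theorem IsQuadriculatedDisk.exists_cornerDiff_eq_of_dvd [Finite F] (hG : G.IsQuadriculatedDisk)
    (hn : n ≠ 0) {x φ : F × Fin 4 → ℤ} (hx : ∀ s, x (G.flip s) = x s)
    (hx_zero : ∀ s, G.mate s = none → x s = 0)
    (hφ : ∀ s, color s.1 = false → G.mate s ≠ none → φ s = 0)
    (hdvd : ∀ s, n ∣ (cornerDiff x - (φ - φ ∘ (partner color).symm)) s) :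
    ∃ z ψ : F × Fin 4 → ℤ, (∀ s, z (G.flip s) = z s) ∧ (∀ s, G.mate s = none → z s = 0) ∧
      (∀ s, color s.1 = false → G.mate s ≠ none → ψ s = 0) ∧
      cornerDiff z = ψ - ψ ∘ (partner color).symm ∧ ∀ s, n ∣ ψ s - φ s := by
  obtain ⟨ψ, hψ, hflow, hψφ⟩ := exists_netFlow_eq_zero_of_dvd (tail := G.vtx ∘ partner color)
    (head := G.vtx) (s := {s | color s.1 = false → G.mate s = none}) hn (φ := φ)
    (fun s hs => hφ s (of_not_imp hs) (not_of_not_imp hs)) fun v => by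
      have := dvd_cornerSum hdvd v
      rw [map_sub, cornerSum_cornerDiff hx hx_zero, zero_sub] at this
      rw [netFlow_comp_perm]
      exact dvd_neg.1 this
  rw [netFlow_comp_perm] at hflow
  obtain ⟨z, hz, hz_zero, hzψ⟩ := hG.exists_cornerDiff_eq (sum_sub_partner_symm ψ) hflow
  exact ⟨z, ψ, hz, hz_zero, fun s hs h => hψ s fun h' => h (h' hs), hzψ, hψφ⟩

theorem IsTwistedKernel.exists_lift [Finite F] (hG : G.IsQuadriculatedDisk)
    (hcolor : G.IsBicoloring color) (hn : n ≠ 0) {y : F × Fin 4 → ℤ}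
    (hy : G.IsTwistedKernel color n y) :
    ∃ y', G.IsTwistedKernel color 0 y' ∧ ∀ s, n ∣ y' s - y s := by
  obtain ⟨φ, hφ, hzero, hdvd⟩ := hy.exists_dvd_cornerDiff_sub
  generalize hx : y - whitePart color φ = x at hzero hdvd
  have hflip (s : F × Fin 4) : x (G.flip s) = x s := by
    simp only [← hx, Pi.sub_apply, hy.flip, whitePart_flip hφ]
  obtain ⟨z, ψ, hz, hz_zero, hψ, hzψ, hψφ⟩ :=
    hG.exists_cornerDiff_eq_of_dvd hn hflip hzero hφ hdvd
  refine ⟨_, isTwistedKernel_add_whitePart hψ hz hz_zero hzψ, fun s => ?_⟩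
  obtain ⟨e, he⟩ := hG.exists_mate_eq_none hcolor
  have hdiff (s) : cornerDiff (z - x) s = ψ s - φ s -
      (ψ ((partner color).symm s) - φ ((partner color).symm s)) -
        (cornerDiff x - (φ - φ ∘ (partner color).symm)) s := by
    rw [map_sub, hzψ]
    simp only [Pi.sub_apply, comp_apply]
    ring
  have hzx : n ∣ (z - x) s :=
    dvd_of_dvd_cornerDiff hG (s := e) (fun s => by simp only [Pi.sub_apply, hz, hflip])
      (fun s => hdiff s ▸ dvd_sub (dvd_sub (hψφ s) (hψφ _)) (hdvd s))
      (by simp [hz_zero e he, hzero e he]) s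
  have hwhite : n ∣ whitePart color ψ s - whitePart color φ s := by
    cases hs : color s.1 <;> simp [whitePart, hs, hψφ s]
  have hsub : (z + whitePart color ψ) s - y s =
      (z - x) s + (whitePart color ψ s - whitePart color φ s) := by
    simp only [← hx, Pi.add_apply, Pi.sub_apply]
    ring
  exact hsub ▸ dvd_add hzx hwhite

end Lift

section Untwist

variable {F : Type*} {G : SquareGluing F} {color : F → Bool} {ε κ : F → ℤˣ} {n : ℤ}

/-- The sum of a function over the neighbors of a square, counted by shared sides. -/
def neighborSum (G : SquareGluing F) (x : F → ℤ) (f : F) : ℤ :=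
  ∑ i, (G.mate (f, i)).elim 0 fun s => x s.1

/-- The function on sides that encodes a function on the white squares: a side carries the value
at the white square that it bounds, or `0` if there is none. -/
def sideValue (G : SquareGluing F) (color : F → Bool) (z : F → ℤ) (s : F × Fin 4) : ℤ :=
  if color s.1 then (G.mate s).elim 0 fun s' => z s'.1 else z s.1

theorem sideValue_flip (hcolor : G.IsBicoloring color) (z : F → ℤ) (s : F × Fin 4) :
    G.sideValue color z (G.flip s) = G.sideValue color z s := by
  rcases h : G.mate s with _ | s'
  · rw [flip_of_mate_eq_none h]
  · have h' := G.mate_symm _ _ h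
    have hc := hcolor s.1 s'.1 ⟨s.2, s'.2, h⟩
    rw [flip_of_mate h]
    rcases hs : color s.1 <;> rcases hs' : color s'.1 <;> simp_all [sideValue]

theorem neighborSum_units_mul
    (hε : ∀ s s', G.mate s = some s' → ε s'.1 = κ s.1 * (-1) ^ (s.2 : ℕ)) (z : F → ℤ) {f : F}
    (hf : color f = true) :
    G.neighborSum (fun g => ε g * z g) f =
      κ f * ∑ i : Fin 4, (-1) ^ (i : ℕ) * G.sideValue color z (f, i) := by
  rw [neighborSum, Finset.mul_sum]
  refine Finset.sum_congr rfl fun i _ => ?_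
  rcases h : G.mate (f, i) with _ | s
  · simp [sideValue, hf, h]
  · simp [sideValue, hf, h, hε _ _ h, mul_assoc]

theorem isTwistedKernel_sideValue_iff (hcolor : G.IsBicoloring color)
    (hε : ∀ s s', G.mate s = some s' → ε s'.1 = κ s.1 * (-1) ^ (s.2 : ℕ)) {z : F → ℤ} :
    G.IsTwistedKernel color n (G.sideValue color z) ↔
      ∀ f, color f = true → n ∣ G.neighborSum (fun g => ε g * z g) f := by
  have hdvd (f : F) (hf : color f = true) :
      n ∣ G.neighborSum (fun g => ε g * z g) f ↔
        n ∣ ∑ i : Fin 4, (-1) ^ (i : ℕ) * G.sideValue color z (f, i) := by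
    rw [neighborSum_units_mul hε z hf, (κ f).isUnit.dvd_mul_left]
  refine ⟨fun hz f hf => (hdvd f hf).2 (hz.dvd_sum f hf), fun hz => ?_⟩
  exact {
    flip := sideValue_flip hcolor z
    black_zero := fun s hs h => by simp [sideValue, hs, h]
    white_const := fun s hs => by simp [sideValue, next_apply, hs]
    dvd_sum := fun f hf => (hdvd f hf).1 (hz f hf) }

theorem IsTwistedKernel.sideValue_eq (hcolor : G.IsBicoloring color) {y : F × Fin 4 → ℤ}
    (hy : G.IsTwistedKernel color n y) : G.sideValue color (fun f => y (f, 0)) = y := by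
  have hwhite (s : F × Fin 4) (hs : color s.1 = false) : y (s.1, 0) = y s := by
    have hnext (i : Fin 4) : y (s.1, i + 1) = y (s.1, i) := hy.white_const (s.1, i) hs
    obtain ⟨f, i⟩ := s
    fin_cases i
    exacts [rfl, (hnext 0).symm, ((hnext 1).trans (hnext 0)).symm, hnext 3]
  funext s
  rcases hs : color s.1
  · simpa [sideValue, hs] using hwhite s hs
  rcases h : G.mate s with _ | s'
  · simp [sideValue, hs, h, hy.black_zero s hs h]
  · have hs' : color s'.1 = false := by simpa [hs] using hcolor s.1 s'.1 ⟨s.2, s'.2, h⟩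
    rw [← hy.flip s, flip_of_mate h, ← hwhite s' hs']
    simp [sideValue, hs, h]

theorem IsQuadriculatedDisk.exists_neighborSum_eq_zero [Finite F] (hG : G.IsQuadriculatedDisk)
    (hcolor : G.IsBicoloring color) (hn : n ≠ 0) {x : F → ℤ}
    (hx : ∀ f, color f = true → n ∣ G.neighborSum x f) :
    ∃ x' : F → ℤ, (∀ f, color f = false → n ∣ x' f - x f) ∧
      ∀ f, color f = true → G.neighborSum x' f = 0 := by
  obtain ⟨ε, κ, hε⟩ := hG.exists_sign hcolor
  have hεε (f : F) (a : ℤ) : (ε f : ℤ) * (ε f * a) = a := by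
    rw [← mul_assoc, Int.units_coe_mul_self, one_mul]
  have hker : G.IsTwistedKernel color n (G.sideValue color fun f => ε f * x f) := by
    simpa only [isTwistedKernel_sideValue_iff hcolor hε, hεε] using hx
  obtain ⟨y, hy, hdvd⟩ := hker.exists_lift hG hcolor hn
  refine ⟨fun f => ε f * y (f, 0), fun f hf => ?_, fun f hf => zero_dvd_iff.1 ?_⟩
  · have hyx := (hdvd (f, 0)).mul_left (ε f)
    simpa [sideValue, hf, mul_sub, hεε] using hyx
  · rw [← hy.sideValue_eq hcolor, isTwistedKernel_sideValue_iff hcolor hε] at hy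
    exact hy f hf

end Untwist

section Matrix

variable {F : Type*} {G : SquareGluing F} {color : F → Bool} {b w : ℕ}

open Classical in
theorem elim_mate_eq_sum (hcolor : G.IsBicoloring color)
    (white : Fin w ≃ {f : F // color f = false}) (x : F → ℤ) {f : F}
    (hf : color f = true) (i : Fin 4) :
    ((G.mate (f, i)).elim 0 fun s => x s.1) =
      ∑ l, if ∃ j, G.mate (f, i) = some ((white l : F), j) then x (white l) else 0 := by
  rcases h : G.mate (f, i) with _ | ⟨g, j⟩
  · simp
  · have hg : color g = false := by simpa [hf] using hcolor f g ⟨i, j, h⟩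
    obtain ⟨l, hl⟩ := white.surjective ⟨g, hg⟩
    obtain rfl : (white l : F) = g := congrArg Subtype.val hl
    simp [Subtype.val_inj]

variable [Finite F]

theorem IsQuadriculatedDisk.card_mate_eq_some (hG : G.IsQuadriculatedDisk)
    (hcolor : G.IsBicoloring color) (f g : F) [Decidable (G.ShareSide f g)]
    [DecidablePred fun i => ∃ j, G.mate (f, i) = some (g, j)] :
    ({i | ∃ j, G.mate (f, i) = some (g, j)} : Finset (Fin 4)).card =
      if G.ShareSide f g then 1 else 0 := by
  split_ifs with h
  · rw [Finset.card_eq_one]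
    obtain ⟨i, j, hij⟩ := h
    refine ⟨i, Finset.ext fun i' => ?_⟩
    simp only [Finset.mem_filter_univ, Finset.mem_singleton]
    refine ⟨fun ⟨j', h'⟩ => congrArg Prod.snd (hG.side_unique hcolor h' hij rfl rfl), ?_⟩
    rintro rfl
    exact ⟨j, hij⟩
  · rw [Finset.card_eq_zero, Finset.filter_eq_empty_iff]
    exact fun i _ ⟨j, hij⟩ => h ⟨i, j, hij⟩

theorem IsQuadriculatedDisk.blackToWhite_mulVec (hG : G.IsQuadriculatedDisk)
    (hcolor : G.IsBicoloring color) (black : Fin b ≃ {f : F // color f = true})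
    (white : Fin w ≃ {f : F // color f = false}) (x : F → ℤ) (k : Fin b) :
    (G.blackToWhite black white).mulVec (fun l => x (white l)) k =
      G.neighborSum x (black k) := by
  classical
  simp only [neighborSum, elim_mate_eq_sum hcolor white x (black k).2]
  rw [Finset.sum_comm, Matrix.mulVec, dotProduct]
  refine Finset.sum_congr rfl fun l _ => ?_
  rw [← Finset.sum_filter, Finset.sum_const, hG.card_mate_eq_some hcolor, ite_smul, one_smul,
    zero_smul, blackToWhite, Matrix.of_apply, ite_mul, one_mul, zero_mul]

theorem IsQuadriculatedDisk.exists_blackToWhite_mulVec_eq_of_smul (hG : G.IsQuadriculatedDisk)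
    (hcolor : G.IsBicoloring color) (black : Fin b ≃ {f : F // color f = true})
    (white : Fin w ≃ {f : F // color f = false}) {n : ℤ} (hn : n ≠ 0) {v : Fin b → ℤ}
    {x : Fin w → ℤ} (h : (G.blackToWhite black white).mulVec x = n • v) :
    ∃ y, (G.blackToWhite black white).mulVec y = v := by
  have hwhite : Injective fun l => (white l : F) := Subtype.val_injective.comp white.injective
  obtain ⟨X, rfl⟩ : ∃ X : F → ℤ, (fun l => X (white l)) = x :=
    ⟨extend (fun l => (white l : F)) x 0, funext fun l => hwhite.extend_apply x 0 l⟩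
  have hX (f : F) (hf : color f = true) : n ∣ G.neighborSum X f := by
    obtain ⟨k, hk⟩ := black.surjective ⟨f, hf⟩
    obtain rfl : (black k : F) = f := congrArg Subtype.val hk
    rw [← hG.blackToWhite_mulVec hcolor black white, h]
    exact ⟨v k, rfl⟩
  obtain ⟨X', hdvd, hX'⟩ := hG.exists_neighborSum_eq_zero hcolor hn hX
  have hker : (G.blackToWhite black white).mulVec (fun l => X' (white l)) = 0 :=
    funext fun k => (hG.blackToWhite_mulVec hcolor black white X' k).trans (hX' _ (black k).2)
  choose y hy using fun l => hdvd (white l) (white l).2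
  have hxy : (fun l => X (white l)) = (fun l => X' (white l)) - n • y :=
    funext fun l => by simp [← hy l]
  rw [hxy, Matrix.mulVec_sub, hker, zero_sub, Matrix.mulVec_smul, ← smul_neg,
    ← Matrix.mulVec_neg] at h
  exact ⟨-y, smul_right_injective _ hn h⟩

end Matrix

end SquareGluing

theorem free_quotient_of_smul_mem {R M : Type*} [CommRing R] [IsDomain R]
    [IsPrincipalIdealRing R] [AddCommGroup M] [Module R M] [Module.Finite R M] {N : Submodule R M}
    (hN : ∀ (r : R) (v : M), r ≠ 0 → r • v ∈ N → v ∈ N) : Module.Free R (M ⧸ N) := by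
  have : Module.IsTorsionFree R (M ⧸ N) := by
    rw [Module.isTorsionFree_iff_smul_eq_zero]
    rintro r q h
    obtain ⟨v, rfl⟩ := N.mkQ_surjective q
    rw [← map_smul, ← LinearMap.mem_ker, N.ker_mkQ] at h
    rw [← LinearMap.mem_ker, N.ker_mkQ]
    exact or_iff_not_imp_left.2 fun hr => hN r v hr h
  exact Module.free_of_finite_type_torsion_free'

theorem exists_mulVec_eq_smul_of_map_mulVec_eq {R K m n : Type*} [CommRing R] [IsDomain R]
    [Field K] [Algebra R K] [IsFractionRing R K] [Fintype n] {B : Matrix m n R} {v : m → R}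
    {x : n → K} (hx : (B.map (algebraMap R K)).mulVec x = fun i => algebraMap R K (v i)) :
    ∃ (r : R) (y : n → R), r ≠ 0 ∧ B.mulVec y = r • v := by
  obtain ⟨⟨r, hr⟩, hrx⟩ :=
    IsLocalization.exist_integer_multiples_of_finite (nonZeroDivisors R) x
  choose y hy using hrx
  refine ⟨r, y, nonZeroDivisors.ne_zero hr, funext fun i => IsFractionRing.injective R K ?_⟩
  have hyx : algebraMap R K ∘ y = r • x := funext hy
  rw [RingHom.map_mulVec, hyx, Matrix.mulVec_smul, hx]
  simp [Algebra.smul_def]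

theorem rank_map_algebraMap {R A m n : Type*} [CommRing R] [CommRing A] [Algebra R A] [Finite m]
    [Fintype n] (B : Matrix m n R) :
    (B.map (algebraMap R A)).rank =
      Module.finrank A (LinearMap.range (B.mulVecLin.baseChange A)) := by
  classical
  let bn := Algebra.TensorProduct.basis A (Pi.basisFun R n)
  let bm := Algebra.TensorProduct.basis A (Pi.basisFun R m)
  have hB : LinearMap.toMatrix bn bm (B.mulVecLin.baseChange A) = B.map (algebraMap R A) := by
    rw [LinearMap.toMatrix_baseChange, ← Matrix.toLin'_apply', ← Matrix.toLin_eq_toLin',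
      LinearMap.toMatrix_toLin]
  rw [← hB, Matrix.rank_eq_finrank_range_toLin _ bm bn, Matrix.toLin_toMatrix]

theorem rank_map_algebraMap_add_finrank_cokernel {R K m n : Type*} [CommRing R] [Field K]
    [Algebra R K] [Fintype m] [Fintype n] (B : Matrix m n R)
    [Module.Free R ((m → R) ⧸ LinearMap.range B.mulVecLin)] :
    (B.map (algebraMap R K)).rank +
      Module.finrank R ((m → R) ⧸ LinearMap.range B.mulVecLin) = Fintype.card m := by
  have : Nontrivial R := (algebraMap R K).domain_nontrivial
  let π := (LinearMap.range B.mulVecLin).mkQ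
  have hsurj : Surjective (π.baseChange K) :=
    LinearMap.lTensor_surjective K (Submodule.mkQ_surjective _)
  have hexact : LinearMap.ker (π.baseChange K) = LinearMap.range (B.mulVecLin.baseChange K) :=
    LinearMap.exact_iff.1 (lTensor_exact K (LinearMap.exact_map_mkQ_range B.mulVecLin)
      (Submodule.mkQ_surjective _))
  calc (B.map (algebraMap R K)).rank + Module.finrank R ((m → R) ⧸ LinearMap.range B.mulVecLin)
      = Module.finrank K (LinearMap.range (π.baseChange K)) +
          Module.finrank K (LinearMap.ker (π.baseChange K)) := by
        rw [rank_map_algebraMap, ← hexact, add_comm, ← Module.finrank_baseChange (R := K),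
          LinearMap.range_eq_top.2 hsurj, finrank_top]
    _ = Fintype.card m := by
        rw [LinearMap.finrank_range_add_finrank_ker, Module.finrank_baseChange,
          Module.finrank_fintype_fun_eq_card]

theorem corollary3 {F : Type*} [Finite F] (G : SquareGluing F) (hG : G.IsQuadriculatedDisk)
    (color : F → Bool) (hcolor : G.IsBicoloring color) (b w : ℕ)
    (black : Fin b ≃ {f : F // color f = true}) (white : Fin w ≃ {f : F // color f = false}) :
    (∀ v : Fin b → ℤ,
      (∃ x : Fin w → ℚ,
        ((G.blackToWhite black white).map (Int.cast : ℤ → ℚ)).mulVec x = fun i => (v i : ℚ)) →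
      ∃ y : Fin w → ℤ, (G.blackToWhite black white).mulVec y = v) ∧
    Module.Free ℤ ((Fin b → ℤ) ⧸ LinearMap.range (G.blackToWhite black white).mulVecLin) ∧
    ∀ p : ℕ, p.Prime →
      ((G.blackToWhite black white).map (Int.cast : ℤ → ZMod p)).rank =
        ((G.blackToWhite black white).map (Int.cast : ℤ → ℚ)).rank := by
  have hfree := free_quotient_of_smul_mem
    (N := LinearMap.range (G.blackToWhite black white).mulVecLin) fun n v hn ⟨_, hx⟩ =>
      hG.exists_blackToWhite_mulVec_eq_of_smul hcolor black white hn hx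
  refine ⟨fun v ⟨x, hx⟩ => ?_, hfree, fun p hp => ?_⟩
  · obtain ⟨n, y, hn, hy⟩ := exists_mulVec_eq_smul_of_map_mulVec_eq hx
    exact hG.exists_blackToWhite_mulVec_eq_of_smul hcolor black white hn hy
  · have := Fact.mk hp
    have hrank := rank_map_algebraMap_add_finrank_cokernel (K := ZMod p)
      (G.blackToWhite black white)
    have hrankQ := rank_map_algebraMap_add_finrank_cokernel (K := ℚ)
      (G.blackToWhite black white)
    exact Nat.add_right_cancel (hrank.trans hrankQ.symm)
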